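/- A signed graph $(G,\Sigma)$ is a finite simple graph $G$ with a set $\Sigma\subseteq E(G)$ of edges, called odd; the other edges of $G$ are called even. Let $N^-(u)$ and $N^+(u)$ be the sets of neighbors of a vertex $u$ joined to $u$ by an odd, respectively even, edge. The signed Laplacian matrix is $L(G,\Sigma)=D(G)-A(G,\Sigma)$, where $D(G)$ is the diagonal matrix of vertex degrees of $G$ and $A(G,\Sigma)$ has entry $1$ for even edges, $-1$ for odd edges and $0$ elsewhere. The spectrum of $(G,\Sigma)$ is the multiset of eigenvalues of $L(G,\Sigma)$. For distinct non-adjacent vertices $v,w$, spectral integral variation of type 2 occurs under the addition of an even edge $vw$ if the spectrum of $(G+vw,\Sigma)$ is obtained from the spectrum of $(G,\Sigma)$ by increasing two eigenvalues (counted with multiplicity) by $1$ each and leaving all the others unchanged. **Theorem.** Let $(G,\Sigma)$ be a signed graph and let $v$ and $w$ be distinct non-adjacent vertices of $G$ of degrees $d_1$ and $d_2$, respectively. Suppose that, for some ordering of the vertices, $L(G,\Sigma)$ is given as $$\left[\begin{array}{rr|r|r|r|r|r} d_1 & 0 & -\mathbf{1}^t & \mathbf{0}^t & -\mathbf{1}^t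 & -\mathbf{1}^t & \mathbf{0}^t\\ 0 & d_2 & \mathbf{0}^t & -\mathbf{1}^t & -\mathbf{1}^t & \mathbf{1}^t & \mathbf{0}^t\\\hline -\mathbf{1} & \mathbf{0} & L_{11} & L_{12} & L_{13} & L_{14} & L_{15}\\\hline \mathbf{0} & -\mathbf{1} & L_{21} & L_{22} & L_{23} & L_{24} & L_{25}\\\hline -\mathbf{1} & -\mathbf{1} & L_{31} & L_{32} & L_{33} & L_{34} & L_{35}\\\hline -\mathbf{1} & \mathbf{1} & L_{41} & L_{42} & L_{43} & L_{44} & L_{45}\\\hline \mathbf{0} & \mathbf{0} & L_{51} & L_{52} & L_{53} & L_{54} & L_{55} \end{array}\right]$$ where the first and the second columns are indexed by $v$ and $w$, respectively, $\mathbf{1}$ and $\mathbf{0}$ are the all-ones and zero vectors, and each of the last five blocks may be empty. Consider the conditions $$\begin{aligned} L_{11}\mathbf{1}-L_{12}\mathbf{1}+2L_{14}\mathbf{1}&=(d_2+1)\mathbf{1},&&\text{(a)}\\ L_{21}\mathbf{1}-L_{22}\mathbf{1}+2L_{24}\mathbf{1}&=-(d_1+1)\mathbf{1},&&\text{(b)}\\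 L_{31}\mathbf{1}-L_{32}\mathbf{1}+2L_{34}\mathbf{1}&=-(d_1-d_2)\mathbf{1},&&\text{(c)}\\ L_{41}\mathbf{1}-L_{42}\mathbf{1}+2L_{44}\mathbf{1}&=(d_1+d_2+2)\mathbf{1},&&\text{(d)}\\ L_{51}\mathbf{1}-L_{52}\mathbf{1}+2L_{54}\mathbf{1}&=\mathbf{0}.&&\text{(e)} \end{aligned}$$ If spectral integral variation of type 2 occurs under the addition of an even edge $vw$, then (a)–(e) hold. Conversely, if (a)–(e) hold and it is not the case that both $N^+(v)=N^+(w)$ and $N^-(v)=N^-(w)$, then spectral integral variation of type 2 occurs under the addition of an even edge $vw$. In particular, whenever $N^+(v)\neq N^+(w)$ or $N^-(v)\neq N^-(w)$, type 2 occurs if and only if (a)–(e) hold. -/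

import Mathlib

open scoped Matrix

/-- A signed graph `(G, Σ)` on the vertex set `V`: a simple graph `G` together with a set `Σ` of
edges of `G`. The edges in `Σ` are the odd edges, the other edges of `G` are the even edges. -/
structure SignedGraph (V : Type*) where
  /-- the underlying graph `G` -/
  graph : SimpleGraph V
  /-- the sign `Σ`, the set of odd edges -/
  odd : Set (Sym2 V)
  odd_subset : odd ⊆ graph.edgeSet

namespace SignedGraph

variable {V : Type*}

/-- The odd neighborhood `N⁻(u)`: the neighbors of `u` joined to `u` by an odd edge. -/
def oddNeighborSet (S : SignedGraph V) (u : V) : Set V :=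
  {x | S.graph.Adj u x ∧ s(u, x) ∈ S.odd}

/-- The even neighborhood `N⁺(u)`: the neighbors of `u` joined to `u` by an even edge. -/
def evenNeighborSet (S : SignedGraph V) (u : V) : Set V :=
  {x | S.graph.Adj u x ∧ s(u, x) ∉ S.odd}

/-- `(G + vw, Σ)`: the signed graph obtained by adding the edge `vw`, which is even when `v` and
`w` are distinct non-adjacent vertices of `G`. -/
def addEvenEdge (S : SignedGraph V) (v w : V) : SignedGraph V where
  graph := S.graph ⊔ SimpleGraph.edge v w
  odd := S.odd
  odd_subset := S.odd_subset.trans (SimpleGraph.edgeSet_mono le_sup_left)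

open Classical in
/-- The degree of a vertex in the underlying graph. -/
noncomputable def degree [Fintype V] (S : SignedGraph V) (u : V) : ℕ :=
  S.graph.degree u

open Classical in
/-- The adjacency matrix `A(G, Σ)`: the entry is `1` for an even edge, `-1` for an odd edge, and `0`
otherwise. -/
noncomputable def adjMatrix (S : SignedGraph V) : Matrix V V ℝ :=
  Matrix.of fun i j => if S.graph.Adj i j then (if s(i, j) ∈ S.odd then -1 else 1) else 0

/-- The signed Laplacian matrix `L(G, Σ) = D(G) - A(G, Σ)`. -/
noncomputable def laplacian [Fintype V] [DecidableEq V] (S : SignedGraph V) : Matrix V V ℝ :=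
  Matrix.diagonal (fun u => (S.degree u : ℝ)) - S.adjMatrix

/-- The spectrum of `(G, Σ)`: the multiset of eigenvalues of the (real symmetric) matrix `L(G, Σ)`,
counted with multiplicity. -/
noncomputable def spectrum [Fintype V] [DecidableEq V] (S : SignedGraph V) : Multiset ℝ :=
  S.laplacian.charpoly.roots

/-- Spectral integral variation of type 2 occurs under the addition of an even edge `vw`: the
spectrum of `(G + vw, Σ)` is obtained from that of `(G, Σ)` by increasing two eigenvalues
by `1` each, all the others being unchanged. -/
def IntegralVariationTypeTwo [Fintype V] [DecidableEq V] (S : SignedGraph V) (v w : V) : Prop :=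
  ∃ (a b : ℝ) (R : Multiset ℝ),
    S.spectrum = a ::ₘ b ::ₘ R ∧ (S.addEvenEdge v w).spectrum = (a + 1) ::ₘ (b + 1) ::ₘ R

end SignedGraph

/-- The block matrix
```
[ d₁   0  | -1ᵗ   0ᵗ  -1ᵗ  -1ᵗ   0ᵗ ]
[ 0    d₂ |  0ᵗ  -1ᵗ  -1ᵗ   1ᵗ   0ᵗ ]
[ -1   0  | L₁₁  L₁₂  L₁₃  L₁₄  L₁₅ ]
[ 0   -1  | L₂₁  L₂₂  L₂₃  L₂₄  L₂₅ ]
[ -1  -1  | L₃₁  L₃₂  L₃₃  L₃₄  L₃₅ ]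
[ -1   1  | L₄₁  L₄₂  L₄₃  L₄₄  L₄₅ ]
[ 0    0  | L₅₁  L₅₂  L₅₃  L₅₄  L₅₅ ]
```
Here `ι k` indexes the rows of the `(k + 1)`-st of the last five blocks (it may be empty), and
`L i j` is the block `L_{i+1, j+1}`. -/
def centeredBlockMatrix {ι : Fin 5 → Type*} (d₁ d₂ : ℝ)
    (L : (i j : Fin 5) → Matrix (ι i) (ι j) ℝ) :
    Matrix (Fin 2 ⊕ (Σ i, ι i)) (Fin 2 ⊕ (Σ i, ι i)) ℝ :=
  let c : Matrix (Fin 2) (Fin 5) ℝ := !![-1, 0, -1, -1, 0; 0, -1, -1, 1, 0]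
  Matrix.fromBlocks
    !![d₁, 0; 0, d₂]
    (Matrix.of fun r q => c r q.1)
    (Matrix.of fun p r => c r p.1)
    (Matrix.of fun p q => L p.1 q.1 p.2 q.2)

/-- The five block row-sum identities (a)–(e), where `1` denotes an all-ones vector. -/
def BlockRowSumIdentities {ι : Fin 5 → Type*} [∀ i, Fintype (ι i)] (d₁ d₂ : ℝ)
    (L : (i j : Fin 5) → Matrix (ι i) (ι j) ℝ) : Prop :=
  (L 0 0 *ᵥ 1 - L 0 1 *ᵥ 1 + (2 : ℝ) • (L 0 3 *ᵥ 1) = (d₂ + 1) • 1) ∧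
  (L 1 0 *ᵥ 1 - L 1 1 *ᵥ 1 + (2 : ℝ) • (L 1 3 *ᵥ 1) = (-(d₁ + 1)) • 1) ∧
  (L 2 0 *ᵥ 1 - L 2 1 *ᵥ 1 + (2 : ℝ) • (L 2 3 *ᵥ 1) = (-(d₁ - d₂)) • 1) ∧
  (L 3 0 *ᵥ 1 - L 3 1 *ᵥ 1 + (2 : ℝ) • (L 3 3 *ᵥ 1) = (d₁ + d₂ + 2) • 1) ∧
  (L 4 0 *ᵥ 1 - L 4 1 *ᵥ 1 + (2 : ℝ) • (L 4 3 *ᵥ 1) = 0)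

/-!
Put `A = L(G, Σ)` and `x = e_v - e_w`. Adding the even edge `vw` replaces `A` by the rank-one update
`A + x xᵗ`. If two eigenvalues `a`, `b` increase by `1`, then `x` is annihilated by `(A - a)(A - b)`
and `a + b = xᵗ A x + 1`; the converse holds when `|a - b| > 1`.

* If `A² x = s A x - c x`, then `(t - A)⁻¹ x` is a multiple of `A x + (t - s) x`, and the matrix
  determinant lemma gives the ratio of the two characteristic polynomials explicitly
  (`charpoly_add_vecMulVec_of_quadratic`). If `|x|² = 2` and `s = xᵗ A x + 1`, the ratio is
  `(t - a - 1)(t - b - 1) / ((t - a)(t - b))` with `a + b = s`, `ab = c`; when `|a - b| > 1` no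
  factor cancels, so two roots really move (`exists_roots_charpoly_add_vecMulVec`).
* Conversely, that ratio is `1 - ∑ uᵢ² / (t - dᵢ)`, where `dᵢ` are the eigenvalues of `A` and `uᵢ`
  the coordinates of `x` in an orthonormal eigenbasis. If the ratio has denominator
  `(t - a)(t - b)`, then comparing poles shows `uᵢ = 0` unless `dᵢ ∈ {a, b}`
  (`quadratic_of_charpoly_add_vecMulVec`, `quadratic_of_roots_charpoly_add_vecMulVec`).

For the block matrix, `A x` has the values `d₁, -d₂, -1, 1, 0, -2, 0`, and (a)–(e) say exactly
that `A² x = (d₁ + d₂ + 1) A x` off `v` and `w` (`blockRowSumIdentities_iff`). At `v` and `w`, the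
expressions `d₁ = n₁ + n₃ + n₄` and `d₂ = n₂ + n₃ + n₄` of the degrees by the block sizes `nᵢ` (with
`nᵢ` the size of `ι (i - 1)`, since the blocks are indexed by `Fin 5`) show
that the difference of the two sides is always `-(d₁ d₂ + n₃ - n₄) x`
(`BlockRowSumIdentities.quadratic`). Finally `xᵗ A x = d₁ + d₂`, and the discriminant is
`(a - b)² = (d₁ - d₂)² + 1 + 2 n₁ + 2 n₂ + 8 n₄`, which exceeds `1` as soon as one of the blocks
`1`, `2`, `4` is nonempty, that is, as soon as the signed neighborhoods of `v` and `w` differ.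
-/

open Matrix Polynomial Filter Topology

/-! ### Rank-one updates of a symmetric matrix -/

namespace Matrix

variable {n : Type*} [Fintype n] [DecidableEq n]

/-- A form of the matrix determinant lemma that does not need `M` to be invertible: it is enough
that `x` is in its range. -/
theorem det_sub_vecMulVec_of_mulVec_eq {R : Type*} [CommRing R] {M : Matrix n n R} {x z : n → R}
    (h : M *ᵥ z = x) (w : n → R) : (M - vecMulVec x w).det = M.det * (1 - w ⬝ᵥ z) := by
  have hM : M - vecMulVec x w = M * (1 + vecMulVec (-z) w) := by
    rw [mul_add, mul_one, mul_vecMulVec, mulVec_neg, h, neg_vecMulVec, sub_eq_add_neg]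
  rw [hM, det_mul, vecMulVec_eq Unit, det_one_add_replicateCol_mul_replicateRow,
    dotProduct_neg, sub_eq_add_neg]

/-- Here `z` plays the role of `(t - A)⁻¹ x`. -/
theorem eval_charpoly_add_vecMulVec {A : Matrix n n ℝ} {x z : n → ℝ} {t : ℝ}
    (h : t • z - A *ᵥ z = x) :
    (A + vecMulVec x x).charpoly.eval t = A.charpoly.eval t * (1 - x ⬝ᵥ z) := by
  have hz : (scalar n t - A) *ᵥ z = x := by
    rw [sub_mulVec, ← h, scalar_apply, ← smul_one_eq_diagonal, smul_mulVec, one_mulVec]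
  rw [eval_charpoly, eval_charpoly, ← sub_sub, det_sub_vecMulVec_of_mulVec_eq hz]

/-- If `X² - s X + c` evaluated at `A` annihilates `x`, this relates the characteristic polynomials
of `A` and `A + x xᵗ`. -/
theorem charpoly_add_vecMulVec_of_quadratic {A : Matrix n n ℝ} {x : n → ℝ} {s c : ℝ}
    (h : A *ᵥ (A *ᵥ x) = s • (A *ᵥ x) - c • x) :
    (A + vecMulVec x x).charpoly * (X ^ 2 - C s * X + C c) =
      A.charpoly * (X ^ 2 - C s * X + C c - (C (x ⬝ᵥ A *ᵥ x) + (X - C s) * C (x ⬝ᵥ x))) := by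
  have hq : (X ^ 2 - C s * X + C c : ℝ[X]) ≠ 0 := by
    intro h0
    have := congrArg (fun p => coeff p 2) h0
    simp at this
  refine mul_right_cancel₀ hq (Polynomial.funext fun t => ?_)
  simp only [eval_mul, eval_add, eval_sub, eval_pow, eval_X, eval_C]
  by_cases ht : t ^ 2 - s * t + c = 0
  · simp [ht]
  -- The resolvent at `t` applied to `x`, found from `A² x = s A x - c x`.
  have hz : t • ((t ^ 2 - s * t + c)⁻¹ • (A *ᵥ x + (t - s) • x)) -
      A *ᵥ ((t ^ 2 - s * t + c)⁻¹ • (A *ᵥ x + (t - s) • x)) = x := by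
    rw [mulVec_smul, mulVec_add, mulVec_smul, h]
    ext i
    simp only [Pi.smul_apply, Pi.sub_apply, Pi.add_apply, smul_eq_mul]
    rw [inv_mul_eq_div, inv_mul_eq_div, mul_div_assoc', ← sub_div, div_eq_iff ht]
    ring
  rw [eval_charpoly_add_vecMulVec hz, dotProduct_smul, dotProduct_add, dotProduct_smul]
  simp only [smul_eq_mul]
  rw [inv_mul_eq_div, mul_assoc (eval t A.charpoly), sub_mul, one_mul, div_mul_cancel₀ _ ht]

theorem IsHermitian.exists_orthogonal_diagonal {A : Matrix n n ℝ}
    (hA : A.IsHermitian) : ∃ (U : Matrix n n ℝ) (d : n → ℝ), Uᵀ * U = 1 ∧ U * Uᵀ = 1 ∧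
      A = U * diagonal d * Uᵀ := by
  refine ⟨hA.eigenvectorUnitary, hA.eigenvalues, ?_, ?_, ?_⟩
  · have := Unitary.coe_star_mul_self hA.eigenvectorUnitary
    rwa [star_eq_conjTranspose, conjTranspose_eq_transpose_of_trivial] at this
  · have := Unitary.coe_mul_star_self hA.eigenvectorUnitary
    rwa [Unitary.coe_star, star_eq_conjTranspose, conjTranspose_eq_transpose_of_trivial] at this
  · have := hA.spectral_theorem
    rw [Unitary.conjStarAlgAut_apply, star_eq_conjTranspose,
      conjTranspose_eq_transpose_of_trivial] at this
    exact this

omit [DecidableEq n] in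
/-- If `∑ cᵢ² / (t - dᵢ) = l / q`, then `q` vanishes at every `d k` with `c k ≠ 0`. The poles of the
left side do not cancel because all residues are nonnegative, even when some `dᵢ` coincide. -/
theorem mul_eq_zero_of_partialFractions {c d : n → ℝ} {q l : ℝ[X]}
    (h : ∀ t, (∀ i, t ≠ d i) → q.eval t * ∑ i, c i ^ 2 / (t - d i) = l.eval t) (k : n) :
    q.eval (d k) * c k = 0 := by
  -- Multiply by `t - d k` and let `t → d k`.
  have hterm (i : n) : Tendsto (fun t => c i ^ 2 * ((t - d k) / (t - d i))) (𝓝[≠] d k)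
      (𝓝 (if d i = d k then c i ^ 2 else 0)) := by
    split_ifs with hi
    · refine tendsto_const_nhds.congr' ?_
      filter_upwards [self_mem_nhdsWithin] with t ht
      rw [hi, div_self (sub_ne_zero.2 ht), mul_one]
    · have hc : ContinuousAt (fun t => c i ^ 2 * ((t - d k) / (t - d i))) (d k) := by
        have : d k - d i ≠ 0 := sub_ne_zero.2 (Ne.symm hi)
        fun_prop (disch := assumption)
      simpa using hc.tendsto.mono_left nhdsWithin_le_nhds
  have hl : Tendsto (fun t => q.eval t * ∑ i, c i ^ 2 * ((t - d k) / (t - d i))) (𝓝[≠] d k)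
      (𝓝 (q.eval (d k) * ∑ i, if d i = d k then c i ^ 2 else 0)) :=
    (q.continuous.continuousAt.tendsto.mono_left nhdsWithin_le_nhds).mul
      (tendsto_finsetSum _ fun i _ => hterm i)
  have hr : Tendsto (fun t => l.eval t * (t - d k)) (𝓝[≠] d k) (𝓝 0) := by
    have hc : ContinuousAt (fun t => l.eval t * (t - d k)) (d k) := by fun_prop
    simpa using hc.tendsto.mono_left nhdsWithin_le_nhds
  have hne : ∀ᶠ t in 𝓝[≠] d k, ∀ i, t ≠ d i := by
    refine eventually_all.2 fun i => ?_
    by_cases hi : d k = d i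
    · rw [hi]; exact self_mem_nhdsWithin
    · exact eventually_nhdsWithin_of_eventually_nhds (eventually_ne_nhds hi)
  have heq := tendsto_nhds_unique (hl.congr' (by
    filter_upwards [hne] with t ht
    rw [← h t ht, mul_assoc, Finset.sum_mul]
    congr 1
    exact Finset.sum_congr rfl fun i _ => by ring)) hr
  rcases mul_eq_zero.1 heq with h0 | h0
  · rw [h0, zero_mul]
  · rw [Finset.sum_eq_zero_iff_of_nonneg fun i _ => by positivity] at h0
    have := h0 k (Finset.mem_univ k)
    rw [if_pos rfl] at this
    rw [pow_eq_zero_iff two_ne_zero |>.1 this, mul_zero]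

/-- Converse of `charpoly_add_vecMulVec_of_quadratic` for symmetric `A`: if the ratio of the
characteristic polynomials of `A + x xᵗ` and `A` has denominator `X² - s X + c`, then that
polynomial evaluated at `A` annihilates `x`. -/
theorem quadratic_of_charpoly_add_vecMulVec {A : Matrix n n ℝ} (hA : A.IsHermitian)
    {x : n → ℝ} {s c : ℝ} {l : ℝ[X]}
    (h : (A + vecMulVec x x).charpoly * (X ^ 2 - C s * X + C c) =
      A.charpoly * (X ^ 2 - C s * X + C c - l)) :
    A *ᵥ (A *ᵥ x) = s • (A *ᵥ x) - c • x := by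
  obtain ⟨U, d, hU, hU', rfl⟩ := hA.exists_orthogonal_diagonal
  set A := U * diagonal d * Uᵀ with hAdef
  obtain ⟨u, rfl⟩ : ∃ u, x = U *ᵥ u := ⟨Uᵀ *ᵥ x, by rw [mulVec_mulVec, hU', one_mulVec]⟩
  have hAU (w : n → ℝ) : A *ᵥ (U *ᵥ w) = U *ᵥ (d * w) := by
    rw [hAdef, mulVec_mulVec, mul_assoc, hU, mul_one, ← mulVec_mulVec]
    congr 1
    ext i
    rw [mulVec_diagonal, Pi.mul_apply]
  have hdet (t : ℝ) : A.charpoly.eval t = ∏ i, (t - d i) := by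
    have : scalar n t - A = U * diagonal (fun i => t - d i) * Uᵀ := by
      have : diagonal (fun i => t - d i) = scalar n t - diagonal d := by
        rw [scalar_apply, diagonal_sub]
      rw [this, mul_sub, sub_mul, ← (scalar_commute t (fun r' => Commute.all t r') U).eq,
        mul_assoc, hU', mul_one]
    rw [eval_charpoly, this, det_mul, det_mul, det_diagonal, mul_right_comm, ← det_mul, hU',
      det_one, one_mul]
  have key (k : n) : (X ^ 2 - C s * X + C c : ℝ[X]).eval (d k) * u k = 0 := by
    refine mul_eq_zero_of_partialFractions (l := l) (fun t ht => ?_) k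
    have hz : t • (U *ᵥ fun i => u i / (t - d i)) - A *ᵥ (U *ᵥ fun i => u i / (t - d i)) =
        U *ᵥ u := by
      rw [hAU, ← mulVec_smul, ← mulVec_sub]
      congr 1
      ext i
      have := sub_ne_zero.2 (ht i)
      simp only [Pi.sub_apply, Pi.smul_apply, Pi.mul_apply, smul_eq_mul]
      field_simp
    have hdot : U *ᵥ u ⬝ᵥ (U *ᵥ fun i => u i / (t - d i)) = ∑ i, u i ^ 2 / (t - d i) := by
      rw [dotProduct_mulVec, ← mulVec_transpose, mulVec_mulVec, hU, one_mulVec, dotProduct]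
      exact Finset.sum_congr rfl fun i _ => by ring
    have ht0 : A.charpoly.eval t ≠ 0 := by
      rw [hdet]
      exact Finset.prod_ne_zero_iff.2 fun i _ => sub_ne_zero.2 (ht i)
    have he := congrArg (eval t) h
    rw [eval_mul, eval_mul, eval_charpoly_add_vecMulVec hz, hdot, mul_assoc, eval_sub] at he
    have := mul_left_cancel₀ ht0 he
    linarith
  rw [hAU, hAU, ← mulVec_smul, ← mulVec_smul, ← mulVec_sub]
  congr 1
  ext i
  have := key i
  simp only [eval_add, eval_sub, eval_mul, eval_pow, eval_X, eval_C] at this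
  simp only [Pi.sub_apply, Pi.smul_apply, Pi.mul_apply, smul_eq_mul]
  linarith

omit [Fintype n] [DecidableEq n] in
theorem isHermitian_add_vecMulVec_self {A : Matrix n n ℝ} (hA : A.IsHermitian) (x : n → ℝ) :
    (A + vecMulVec x x).IsHermitian :=
  hA.add (by rw [IsHermitian, conjTranspose_eq_transpose_of_trivial, transpose_vecMulVec])

/-- If two eigenvalues `a`, `b` of a symmetric matrix `A` increase by `1` under the update `x xᵗ`,
then `(A - a)(A - b) x = 0`, and `a + b` is determined by `xᵗ A x`. -/
theorem quadratic_of_roots_charpoly_add_vecMulVec {A : Matrix n n ℝ} (hA : A.IsHermitian)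
    {x : n → ℝ} {a b : ℝ} {R : Multiset ℝ} (h₁ : A.charpoly.roots = a ::ₘ b ::ₘ R)
    (h₂ : (A + vecMulVec x x).charpoly.roots = (a + 1) ::ₘ (b + 1) ::ₘ R) :
    A *ᵥ (A *ᵥ x) = (a + b) • (A *ᵥ x) - (a * b) • x ∧ a + b = x ⬝ᵥ A *ᵥ x + 1 := by
  have e₁ := hA.splits_charpoly.eq_prod_roots_of_monic (charpoly_monic A)
  have e₂ := (isHermitian_add_vecMulVec_self hA x).splits_charpoly.eq_prod_roots_of_monic
    (charpoly_monic _)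
  rw [h₁, Multiset.map_cons, Multiset.map_cons, Multiset.prod_cons, Multiset.prod_cons] at e₁
  rw [h₂, Multiset.map_cons, Multiset.map_cons, Multiset.prod_cons, Multiset.prod_cons] at e₂
  have hq : (X ^ 2 - C (a + b) * X + C (a * b) : ℝ[X]) = (X - C a) * (X - C b) := by
    rw [C_add, C_mul]
    ring
  have hchar : (A + vecMulVec x x).charpoly * (X ^ 2 - C (a + b) * X + C (a * b)) =
      A.charpoly * ((X - C (a + 1)) * (X - C (b + 1))) := by
    rw [hq, e₁, e₂]
    ring
  have hquad := quadratic_of_charpoly_add_vecMulVec hA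
    (l := X ^ 2 - C (a + b) * X + C (a * b) - (X - C (a + 1)) * (X - C (b + 1)))
    (by rw [sub_sub_cancel, hchar])
  refine ⟨hquad, ?_⟩
  -- The two expressions for the ratio of the characteristic polynomials determine `a + b`.
  have hcmp := mul_left_cancel₀ (charpoly_monic A).ne_zero
    ((charpoly_add_vecMulVec_of_quadratic hquad).symm.trans hchar)
  have h0 := congrArg (eval 0) hcmp
  have h1 := congrArg (eval 1) hcmp
  simp only [eval_add, eval_sub, eval_mul, eval_pow, eval_X, eval_C] at h0 h1
  have hx : x ⬝ᵥ x = 2 := by linarith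
  rw [hx] at h0
  linarith

/-- Converse of `quadratic_of_roots_charpoly_add_vecMulVec`. The discriminant bound says that the
roots `a`, `b` of `X² - s X + c` differ by more than `1`; it rules out `b = a + 1`, where the shift
of `a` to `a + 1` alone would account for the change of the characteristic polynomial. -/
theorem exists_roots_charpoly_add_vecMulVec {A : Matrix n n ℝ} {x : n → ℝ}
    (hx : x ⬝ᵥ x = 2) {s c : ℝ} (hs : s = x ⬝ᵥ A *ᵥ x + 1)
    (hdisc : 1 < s ^ 2 - 4 * c) (h : A *ᵥ (A *ᵥ x) = s • (A *ᵥ x) - c • x) :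
    ∃ (a b : ℝ) (R : Multiset ℝ), A.charpoly.roots = a ::ₘ b ::ₘ R ∧
      (A + vecMulVec x x).charpoly.roots = (a + 1) ::ₘ (b + 1) ::ₘ R := by
  obtain ⟨a, b, hsab, hcab, hab⟩ : ∃ a b : ℝ, s = a + b ∧ c = a * b ∧ a + 1 < b := by
    have hr := Real.sq_sqrt (show 0 ≤ s ^ 2 - 4 * c by linarith)
    have hr1 : 1 < √(s ^ 2 - 4 * c) := Real.lt_sqrt_of_sq_lt (by linarith)
    refine ⟨(s - √(s ^ 2 - 4 * c)) / 2, (s + √(s ^ 2 - 4 * c)) / 2, by ring, ?_, by linarith⟩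
    linear_combination (1 / 4) * hr
  have hchar := charpoly_add_vecMulVec_of_quadratic h
  have hq : (X ^ 2 - C s * X + C c : ℝ[X]) = (X - C a) * (X - C b) := by
    rw [hsab, hcab, C_add, C_mul]
    ring
  have hq' : (X ^ 2 - C s * X + C c - (C (x ⬝ᵥ A *ᵥ x) + (X - C s) * C (x ⬝ᵥ x)) : ℝ[X]) =
      (X - C (a + 1)) * (X - C (b + 1)) := by
    have : x ⬝ᵥ A *ᵥ x = a + b - 1 := by linarith
    rw [hq, hx, this, hsab]
    simp only [C_add, C_sub, C_1, C_ofNat]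
    ring
  rw [hq', hq] at hchar
  have hroots := congrArg roots hchar
  have hne (t u : ℝ) : (X - C t) * (X - C u) ≠ 0 :=
    mul_ne_zero (X_sub_C_ne_zero t) (X_sub_C_ne_zero u)
  rw [roots_mul (mul_ne_zero (charpoly_monic _).ne_zero (hne _ _)),
    roots_mul (mul_ne_zero (charpoly_monic _).ne_zero (hne _ _)), roots_mul (hne _ _),
    roots_mul (hne _ _)] at hroots
  simp only [roots_X_sub_C] at hroots
  have hle : ({a} + {b} : Multiset ℝ) ≤ A.charpoly.roots := by
    have hd : Disjoint ({a} + {b} : Multiset ℝ) ({a + 1} + {b + 1}) := by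
      refine Multiset.disjoint_left.2 fun {t} ht ht' => ?_
      simp only [Multiset.mem_add, Multiset.mem_singleton] at ht ht'
      rcases ht with ht | ht <;> rcases ht' with ht' | ht' <;> linarith
    have hle' : ({a} + {b} : Multiset ℝ) ≤ A.charpoly.roots + ({a + 1} + {b + 1}) :=
      hroots ▸ Multiset.le_add_left _ _
    rw [Multiset.le_iff_count] at hle' ⊢
    intro t
    have := hle' t
    by_cases ht : t ∈ ({a} + {b} : Multiset ℝ)
    · rwa [Multiset.count_add _ A.charpoly.roots,
        Multiset.count_eq_zero.2 (Multiset.disjoint_left.1 hd ht), add_zero] at this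
    · rw [Multiset.count_eq_zero.2 ht]
      exact Nat.zero_le _
  obtain ⟨R, hR⟩ := Multiset.le_iff_exists_add.1 hle
  refine ⟨a, b, R, by rw [hR]; simp, ?_⟩
  have : (A + vecMulVec x x).charpoly.roots = {a + 1} + {b + 1} + R := by
    apply add_right_cancel (b := ({a} + {b} : Multiset ℝ))
    rw [hroots, hR]
    abel
  rw [this]
  simp

end Matrix

/-! ### The signed Laplacian -/

namespace SignedGraph

variable {V : Type*}

theorem adjMatrix_self (S : SignedGraph V) (u : V) : S.adjMatrix u u = 0 := by
  simp [adjMatrix]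

theorem mem_evenNeighborSet_iff (S : SignedGraph V) (u y : V) :
    y ∈ S.evenNeighborSet u ↔ S.adjMatrix u y = 1 := by
  classical
  simp only [evenNeighborSet, adjMatrix, Set.mem_ofPred_eq, of_apply]
  split_ifs <;> norm_num <;> tauto

theorem mem_oddNeighborSet_iff (S : SignedGraph V) (u y : V) :
    y ∈ S.oddNeighborSet u ↔ S.adjMatrix u y = -1 := by
  classical
  simp only [oddNeighborSet, adjMatrix, Set.mem_ofPred_eq, of_apply]
  split_ifs <;> norm_num <;> tauto

variable [Fintype V] [DecidableEq V]

theorem laplacian_apply_of_ne (S : SignedGraph V) {u y : V} (h : u ≠ y) :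
    S.laplacian u y = -S.adjMatrix u y := by
  rw [laplacian, Matrix.sub_apply, diagonal_apply_ne _ h, zero_sub]

theorem laplacian_isHermitian (S : SignedGraph V) : S.laplacian.IsHermitian := by
  classical
  rw [IsHermitian, conjTranspose_eq_transpose_of_trivial, laplacian, transpose_sub,
    diagonal_transpose]
  congr 1
  ext i j
  simp only [transpose_apply, adjMatrix, of_apply, S.graph.adj_comm, Sym2.eq_swap]

omit [DecidableEq V] in
open Classical in
theorem cast_degree (S : SignedGraph V) (u : V) :
    (S.degree u : ℝ) = ∑ y, if S.graph.Adj u y then 1 else 0 := by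
  rw [degree, SimpleGraph.degree_eq_sum_if_adj]

/-- The off-diagonal entries of a row of the Laplacian are `0` or `±1`, so their squares add up to
the degree. -/
theorem sum_laplacian_sq (S : SignedGraph V) (u : V) :
    ∑ y, S.laplacian u y ^ 2 = (S.degree u : ℝ) ^ 2 + S.degree u := by
  classical
  have hy (y : V) : S.laplacian u y ^ 2 =
      (if y = u then (S.degree u : ℝ) ^ 2 else 0) + if S.graph.Adj u y then 1 else 0 := by
    by_cases h : y = u
    · subst h
      simp [laplacian, adjMatrix_self]
    · rw [laplacian_apply_of_ne S (Ne.symm h), if_neg h, zero_add, adjMatrix, of_apply]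
      split_ifs <;> norm_num
  simp_rw [hy]
  rw [Finset.sum_add_distrib, ← cast_degree, Finset.sum_ite_eq' Finset.univ u,
    if_pos (Finset.mem_univ u)]

theorem laplacian_addEvenEdge (S : SignedGraph V) {v w : V} (hvw : v ≠ w)
    (hadj : ¬ S.graph.Adj v w) :
    (S.addEvenEdge v w).laplacian = S.laplacian +
      vecMulVec (Pi.single v 1 - Pi.single w 1) (Pi.single v 1 - Pi.single w 1) := by
  classical
  have hadj' : ¬ S.graph.Adj w v := fun h => hadj h.symm
  have hodd : s(v, w) ∉ S.odd := fun h => hadj (S.odd_subset h)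
  have hodd' : s(w, v) ∉ S.odd := fun h => hadj' (S.odd_subset h)
  have hdeg (u : V) : ((S.addEvenEdge v w).degree u : ℝ) =
      S.degree u + if u = v ∨ u = w then 1 else 0 := by
    rw [cast_degree, cast_degree]
    have hy (y : V) : (if (S.addEvenEdge v w).graph.Adj u y then (1 : ℝ) else 0) =
        (if S.graph.Adj u y then 1 else 0) + ((if y = w then if u = v then 1 else 0 else 0) +
          if y = v then if u = w then 1 else 0 else 0) := by
      simp only [addEvenEdge, SimpleGraph.sup_adj, SimpleGraph.edge_adj]
      by_cases h1 : u = v <;> by_cases h2 : u = w <;> by_cases h3 : y = v <;>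
        by_cases h4 : y = w <;> simp_all
    simp_rw [hy]
    rw [Finset.sum_add_distrib, Finset.sum_add_distrib, Finset.sum_ite_eq' Finset.univ w,
      Finset.sum_ite_eq' Finset.univ v]
    by_cases h1 : u = v <;> by_cases h2 : u = w <;> simp_all
  ext i j
  rw [Matrix.add_apply, vecMulVec_apply, laplacian, laplacian, Matrix.sub_apply, Matrix.sub_apply,
    diagonal_apply, diagonal_apply, hdeg]
  simp only [adjMatrix, of_apply, addEvenEdge, SimpleGraph.sup_adj, SimpleGraph.edge_adj,
    Pi.sub_apply, Pi.single_apply]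
  by_cases h1 : i = v <;> by_cases h2 : i = w <;> by_cases h3 : j = v <;>
    by_cases h4 : j = w <;> simp_all [eq_comm] <;> congr

end SignedGraph

/-! ### Block row sums -/

section Block

variable {ι : Fin 5 → Type*} [∀ i, Fintype (ι i)] {d₁ d₂ : ℝ}
  {L : (i j : Fin 5) → Matrix (ι i) (ι j) ℝ}

theorem centeredBlockMatrix_mulVec_diff :
    centeredBlockMatrix d₁ d₂ L *ᵥ Sum.elim ![1, -1] 0 =
      Sum.elim ![d₁, -d₂] (fun p => (![-1, 1, 0, -2, 0] : Fin 5 → ℝ) p.1) := by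
  ext p
  rcases p with p | ⟨i, k⟩
  · fin_cases p <;> simp [centeredBlockMatrix, mulVec, dotProduct]
  · fin_cases i <;> simp [centeredBlockMatrix, mulVec, dotProduct] <;> norm_num

theorem centeredBlockMatrix_mulVec_mulVec_inl :
    (centeredBlockMatrix d₁ d₂ L *ᵥ (centeredBlockMatrix d₁ d₂ L *ᵥ Sum.elim ![1, -1] 0)) ∘
        Sum.inl =
      ![d₁ ^ 2 + Fintype.card (ι 0) + 2 * Fintype.card (ι 3),
        -(d₂ ^ 2 + Fintype.card (ι 1) + 2 * Fintype.card (ι 3))] := by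
  rw [centeredBlockMatrix_mulVec_diff]
  ext p
  fin_cases p <;>
  · simp [centeredBlockMatrix, mulVec, dotProduct, Fintype.sum_sigma, Fin.sum_univ_five]
    ring

/-- The left-hand side of the `i`-th identity among (a)–(e) is, up to sign and a constant, the
`i`-th block of `N² (e₀ - e₁)` for the block matrix `N`. -/
theorem centeredBlockMatrix_mulVec_mulVec_inr (i : Fin 5) (k : ι i) :
    (centeredBlockMatrix d₁ d₂ L *ᵥ (centeredBlockMatrix d₁ d₂ L *ᵥ Sum.elim ![1, -1] 0))
        (Sum.inr ⟨i, k⟩) =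
      (![-d₁, d₂, d₂ - d₁, -d₁ - d₂, 0] : Fin 5 → ℝ) i -
        (L i 0 *ᵥ 1 - L i 1 *ᵥ 1 + (2 : ℝ) • (L i 3 *ᵥ 1)) k := by
  rw [centeredBlockMatrix_mulVec_diff]
  have h : (centeredBlockMatrix d₁ d₂ L *ᵥ
      Sum.elim ![d₁, -d₂] (fun p => (![-1, 1, 0, -2, 0] : Fin 5 → ℝ) p.1)) (Sum.inr ⟨i, k⟩) =
      (![-d₁, d₂, d₂ - d₁, -d₁ - d₂, 0] : Fin 5 → ℝ) i +
        (-(∑ x, L i 0 k x) + ∑ x, L i 1 k x - 2 * ∑ x, L i 3 k x) := by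
    simp only [mulVec, dotProduct, Fintype.sum_sum_type, Fintype.sum_sigma, Fin.sum_univ_five,
      Fin.sum_univ_two, centeredBlockMatrix, fromBlocks_apply₂₁, fromBlocks_apply₂₂, of_apply,
      Sum.elim_inl, Sum.elim_inr, ← Finset.sum_mul]
    fin_cases i <;> simp <;> ring
  rw [h]
  simp only [Pi.add_apply, Pi.sub_apply, Pi.smul_apply, mulVec, dotProduct, Pi.one_apply, mul_one,
    smul_eq_mul]
  ring

/-- The identities (a)–(e) say that `N² (e₀ - e₁) = (d₁ + d₂ + 1) N (e₀ - e₁)` outside the first two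
rows of the block matrix `N`. -/
theorem blockRowSumIdentities_iff :
    BlockRowSumIdentities d₁ d₂ L ↔ ∀ p,
      (centeredBlockMatrix d₁ d₂ L *ᵥ (centeredBlockMatrix d₁ d₂ L *ᵥ Sum.elim ![1, -1] 0))
        (Sum.inr p) = (d₁ + d₂ + 1) *
        (centeredBlockMatrix d₁ d₂ L *ᵥ Sum.elim ![1, -1] 0) (Sum.inr p) := by
  have h : BlockRowSumIdentities d₁ d₂ L ↔ ∀ (i : Fin 5) (k : ι i),
      (L i 0 *ᵥ 1 - L i 1 *ᵥ 1 + (2 : ℝ) • (L i 3 *ᵥ 1)) k =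
        (![d₂ + 1, -(d₁ + 1), -(d₁ - d₂), d₁ + d₂ + 2, 0] : Fin 5 → ℝ) i := by
    constructor
    · rintro ⟨ha, hb, hc, hd, he⟩ i k
      fin_cases i
      · simpa using congrFun ha k
      · simpa using congrFun hb k
      · simpa using congrFun hc k
      · simpa using congrFun hd k
      · simpa using congrFun he k
    · intro h
      refine ⟨?_, ?_, ?_, ?_, ?_⟩ <;> ext k
      · simpa using h 0 k
      · simpa using h 1 k
      · simpa using h 2 k
      · simpa using h 3 k
      · simpa using h 4 k
  rw [h, Sigma.forall]
  refine forall₂_congr fun i k => ?_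
  rw [centeredBlockMatrix_mulVec_mulVec_inr, centeredBlockMatrix_mulVec_diff, sub_eq_iff_eq_add,
    ← sub_eq_iff_eq_add', eq_comm, Sum.elim_inr]
  refine Eq.congr_left ?_
  fin_cases i <;> simp <;> ring

theorem sum_centeredBlockMatrix_sq_zero :
    ∑ q, centeredBlockMatrix d₁ d₂ L (Sum.inl 0) q ^ 2 =
      d₁ ^ 2 + (Fintype.card (ι 0) + Fintype.card (ι 2) + Fintype.card (ι 3)) := by
  simp [centeredBlockMatrix, Fintype.sum_sigma, Fin.sum_univ_five]

theorem sum_centeredBlockMatrix_sq_one :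
    ∑ q, centeredBlockMatrix d₁ d₂ L (Sum.inl 1) q ^ 2 =
      d₂ ^ 2 + (Fintype.card (ι 1) + Fintype.card (ι 2) + Fintype.card (ι 3)) := by
  simp [centeredBlockMatrix, Fintype.sum_sigma, Fin.sum_univ_five]

/-- When `d₁` and `d₂` are the degrees expressed by the block sizes, the identities (a)–(e) extend
to a quadratic relation for the block matrix at `e₀ - e₁`, including the first two rows. -/
theorem BlockRowSumIdentities.quadratic (h : BlockRowSumIdentities d₁ d₂ L)
    (h₁ : d₁ = Fintype.card (ι 0) + Fintype.card (ι 2) + Fintype.card (ι 3))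
    (h₂ : d₂ = Fintype.card (ι 1) + Fintype.card (ι 2) + Fintype.card (ι 3)) :
    centeredBlockMatrix d₁ d₂ L *ᵥ (centeredBlockMatrix d₁ d₂ L *ᵥ Sum.elim ![1, -1] 0) =
      (d₁ + d₂ + 1) • (centeredBlockMatrix d₁ d₂ L *ᵥ Sum.elim ![1, -1] 0) -
        (d₁ * d₂ + Fintype.card (ι 2) - Fintype.card (ι 3)) • Sum.elim ![1, -1] 0 := by
  ext p
  rcases p with p | p
  · have hp := congrFun (centeredBlockMatrix_mulVec_mulVec_inl (d₁ := d₁) (d₂ := d₂) (L := L)) p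
    rw [Function.comp_apply] at hp
    rw [hp, centeredBlockMatrix_mulVec_diff]
    fin_cases p <;> simp <;> linarith
  · rw [blockRowSumIdentities_iff.1 h p]
    simp

end Block

theorem theorem1p2 {V : Type*} [Fintype V] [DecidableEq V] (S : SignedGraph V) (v w : V)
    (hvw : v ≠ w) (hadj : ¬ S.graph.Adj v w)
    {ι : Fin 5 → Type*} [∀ i, Fintype (ι i)]
    (e : V ≃ Fin 2 ⊕ (Σ i, ι i)) (hv : e v = Sum.inl 0) (hw : e w = Sum.inl 1)
    (L : (i j : Fin 5) → Matrix (ι i) (ι j) ℝ)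
    (hL : S.laplacian.reindex e e = centeredBlockMatrix (S.degree v : ℝ) (S.degree w : ℝ) L) :
    (S.IntegralVariationTypeTwo v w →
      BlockRowSumIdentities (S.degree v : ℝ) (S.degree w : ℝ) L) ∧
    ((S.evenNeighborSet v ≠ S.evenNeighborSet w ∨ S.oddNeighborSet v ≠ S.oddNeighborSet w) →
      BlockRowSumIdentities (S.degree v : ℝ) (S.degree w : ℝ) L →
      S.IntegralVariationTypeTwo v w) := by
  set d₁ : ℝ := (S.degree v : ℝ)
  set d₂ : ℝ := (S.degree w : ℝ)
  set N := centeredBlockMatrix d₁ d₂ L with hN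
  set x : V → ℝ := Pi.single v 1 - Pi.single w 1 with hx
  have hLap : S.laplacian = N.submatrix e e := by
    rw [← hL]
    ext i j
    simp
  have hentry (u y : V) : S.laplacian u y = N (e u) (e y) := by rw [hLap, submatrix_apply]
  have hxe : x = Sum.elim ![1, -1] 0 ∘ e := by
    classical
    ext y
    have hyv : y = v ↔ e y = Sum.inl 0 := by rw [← hv, e.injective.eq_iff]
    have hyw : y = w ↔ e y = Sum.inl 1 := by rw [← hw, e.injective.eq_iff]
    simp only [hx, Pi.sub_apply, Pi.single_apply, Function.comp_apply, hyv, hyw]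
    rcases e y with p | p
    · fin_cases p <;> simp
    · simp
  have hmul (u : Fin 2 ⊕ (Σ i, ι i) → ℝ) : S.laplacian *ᵥ (u ∘ e) = (N *ᵥ u) ∘ e := by
    rw [hLap, submatrix_mulVec_equiv, Function.comp_assoc, e.self_comp_symm, Function.comp_id]
  have hxx : x ⬝ᵥ x = 2 := by
    simp [hx, hvw, hvw.symm]
    norm_num
  have hxLx : x ⬝ᵥ S.laplacian *ᵥ x = d₁ + d₂ := by
    rw [hxe, hmul, hN, centeredBlockMatrix_mulVec_diff, comp_equiv_dotProduct_comp_equiv]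
    simp [dotProduct]
  have hsum (u : V) : ∑ q, N (e u) q ^ 2 = (S.degree u : ℝ) ^ 2 + S.degree u := by
    rw [← S.sum_laplacian_sq u, ← e.sum_comp]
    simp_rw [hentry]
  have hcard₁ : d₁ = Fintype.card (ι 0) + Fintype.card (ι 2) + Fintype.card (ι 3) := by
    have := hsum v
    rw [hv, hN, sum_centeredBlockMatrix_sq_zero] at this
    linarith
  have hcard₂ : d₂ = Fintype.card (ι 1) + Fintype.card (ι 2) + Fintype.card (ι 3) := by
    have := hsum w
    rw [hw, hN, sum_centeredBlockMatrix_sq_one] at this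
    linarith
  rw [SignedGraph.IntegralVariationTypeTwo, SignedGraph.spectrum, SignedGraph.spectrum,
    S.laplacian_addEvenEdge hvw hadj, ← hx]
  constructor
  · rintro ⟨a, b, R, h₁, h₂⟩
    obtain ⟨hquad, hs⟩ :=
      quadratic_of_roots_charpoly_add_vecMulVec S.laplacian_isHermitian h₁ h₂
    rw [hxLx] at hs
    refine blockRowSumIdentities_iff.2 fun p => ?_
    rw [hs, hxe, hmul, hmul] at hquad
    simpa using congrFun hquad (e.symm (Sum.inr p))
  · intro hne hB
    -- If `ι 0`, `ι 1`, `ι 3` were all empty, `v` and `w` would have the same signed neighbors.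
    have hpos : (1 : ℝ) ≤ Fintype.card (ι 0) + Fintype.card (ι 1) + Fintype.card (ι 3) := by
      by_contra! hlt
      norm_cast at hlt
      have h0 : IsEmpty (ι 0) := Fintype.card_eq_zero_iff.1 (by omega)
      have h1 : IsEmpty (ι 1) := Fintype.card_eq_zero_iff.1 (by omega)
      have h3 : IsEmpty (ι 3) := Fintype.card_eq_zero_iff.1 (by omega)
      have hrow (y : V) : S.adjMatrix v y = S.adjMatrix w y := by
        by_cases hyv : v = y
        · subst hyv
          simp [SignedGraph.adjMatrix, S.graph.adj_comm, hadj]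
        by_cases hyw : w = y
        · subst hyw
          simp [SignedGraph.adjMatrix, hadj]
        rw [← neg_inj, ← S.laplacian_apply_of_ne hyv, ← S.laplacian_apply_of_ne hyw, hentry,
          hentry, hv, hw]
        rcases hp : e y with p | ⟨i, k⟩
        · fin_cases p
          · exact absurd (e.injective (hv.trans hp.symm)) hyv
          · exact absurd (e.injective (hw.trans hp.symm)) hyw
        · fin_cases i
          · exact h0.elim k
          · exact h1.elim k
          · simp [hN, centeredBlockMatrix]
          · exact h3.elim k
          · simp [hN, centeredBlockMatrix]
      rcases hne with hne | hne <;> refine hne (Set.ext fun y => ?_)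
      · rw [S.mem_evenNeighborSet_iff, S.mem_evenNeighborSet_iff, hrow]
      · rw [S.mem_oddNeighborSet_iff, S.mem_oddNeighborSet_iff, hrow]
    refine exists_roots_charpoly_add_vecMulVec hxx
      (s := d₁ + d₂ + 1) (c := d₁ * d₂ + Fintype.card (ι 2) - Fintype.card (ι 3))
      (by rw [hxLx]) ?_ ?_
    -- The discriminant is `(d₁ - d₂)² + 1 + 2 n₀ + 2 n₁ + 8 n₃`, with `nᵢ = |ι i|`.
    · have h3 : (0 : ℝ) ≤ Fintype.card (ι 3) := Nat.cast_nonneg _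
      nlinarith [sq_nonneg (d₁ - d₂)]
    · rw [hxe, hmul, hmul, hN, hB.quadratic hcard₁ hcard₂]
      rfl
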